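/- Fix $n\ge 0$. For $\vec p,\vec q\in\mathbb Z_2^n$ let $Z^{\vec p}|\vec z\rangle=(-1)^{\vec z\cdot\vec p}|\vec z\rangle$, $X^{\vec q}|\vec z\rangle=|\vec z+\vec q\rangle$ on $\mathbb C^{2^n}$, and $W(\vec p,\vec q)=(-i)^{\vec p\cdot\vec q}Z^{\vec p}X^{\vec q}$, the exponent of $-i$ being computed with the bits as integers. A Lagrangian subspace of $\mathbb Z_2^{2n}$ is a subspace that is maximal among those on which the symplectic product $[(\vec p_1,\vec q_1),(\vec p_2,\vec q_2)]=\vec p_1\cdot\vec q_2-\vec p_2\cdot\vec q_1$ vanishes identically. A stabiliser state specified by a Lagrangian subspace $L$ is a unit vector $|s\rangle\in\mathbb C^{2^n}$ such that, for some basis $(\vec p_j,\vec q_j)_{j=1}^n$ of $L$ and bits $\lambda_j\in\mathbb Z_2$, $(-1)^{\lambda_j}W(\vec p_j,\vec q_j)|s\rangle=|s\rangle$ for all $j$. Let $\mathcal S$ be the set of all $n$-qubit stabiliser states whose first nonzero amplitude (in the order of the bit strings $\vec z=z_1\dots z_n$ as binary integers, $z_1$ most significant) is real and positive, and let $\mathcal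 S_N=\mathcal S\setminus\{|\vec z\rangle:\vec z\in\mathbb Z_2^n\}$. The set $\mathcal S$ is finite. Let $\mathcal L_n$ be the complex vector space of all $\alpha:\mathcal S\to\mathbb C$ with $\sum_{|s\rangle\in\mathcal S}\alpha(|s\rangle)|s\rangle=0$; the support of $\alpha$ is the set of $|s\rangle$ with $\alpha(|s\rangle)\neq 0$. Theorem. Every $|s\rangle\in\mathcal S_N$ has a splitting: there are stabiliser states $|t_1\rangle,|t_2\rangle$ (of arbitrary phase), specified by a common Lagrangian subspace, with $|s\rangle=2^{-1/2}(|t_1\rangle+|t_2\rangle)$, such that for some integer $r\ge 1$ the state $|s\rangle$ has exactly $2^r$ nonzero amplitudes and $|t_1\rangle$, $|t_2\rangle$ each have exactly $2^{r-1}$; and there are $\tau_1,\tau_2\in\mathbb C$ with $\tau_j|t_j\rangle\in\mathcal S$ and a function $D_{|s\rangle}:\mathcal S\to\mathbb C$ with $D_{|s\rangle}(|s\rangle)=1$, $D_{|s\rangle}(\tau_j|t_j\rangle)=-2^{-1/2}\tau_j^{-1}$ for $j=1,2$, and value $0$ at all other elements of $\mathcal S$. For every choice of such a $D_{|s\rangle}$,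 one for each $|s\rangle\in\mathcal S_N$, the family $(D_{|s\rangle})_{|s\rangle\in\mathcal S_N}$ is a basis of $\mathcal L_n$, and every $D_{|s\rangle}$ has support of size three. In particular, $\mathcal L_n$ has a basis, indexed by $\mathcal S_N$, in which every vector has support of size three. -/

import Mathlib

namespace Stabiliser

open Matrix Module

/-- Bit strings of length `n`, i.e. the vectors of `ℤ₂ⁿ`; they label the computational basis. -/
abbrev Bits (n : ℕ) : Type := Fin n → ZMod 2

/-- Vectors of `ℂ^(2ⁿ)`, given by their amplitudes `ψ z = ⟨z|ψ⟩` in the computational basis. -/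
abbrev Vec (n : ℕ) : Type := Bits n → ℂ

/-- The computational basis vector `|z⟩`. -/
def ket {n : ℕ} (z : Bits n) : Vec n := Pi.single z 1

/-- `Z^p |z⟩ = (-1)^(z·p) |z⟩`. -/
noncomputable def pauliZ {n : ℕ} (p : Bits n) : Matrix (Bits n) (Bits n) ℂ :=
  Matrix.diagonal fun z => (-1) ^ (z ⬝ᵥ p).val

/-- `X^q |z⟩ = |z + q⟩`. -/
def pauliX {n : ℕ} (q : Bits n) : Matrix (Bits n) (Bits n) ℂ :=
  Matrix.of fun w z => if w = z + q then 1 else 0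

/-- `W(p, q) = (-i)^(p·q) Z^p X^q`, where `p·q` in the exponent of `-i` is computed with the bits
as integers (only its residue modulo 4 matters). -/
noncomputable def pauliW {n : ℕ} (v : Bits n × Bits n) : Matrix (Bits n) (Bits n) ℂ :=
  (-Complex.I) ^ (∑ j, (v.1 j).val * (v.2 j).val) • (pauliZ v.1 * pauliX v.2)

/-- The symplectic product `[(p₁, q₁), (p₂, q₂)] = p₁·q₂ - p₂·q₁` on `ℤ₂²ⁿ`. -/
def symp {n : ℕ} (u v : Bits n × Bits n) : ZMod 2 := u.1 ⬝ᵥ v.2 - v.1 ⬝ᵥ u.2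

/-- Any two members have vanishing symplectic product. -/
def IsIsotropic {n : ℕ} (L : Submodule (ZMod 2) (Bits n × Bits n)) : Prop :=
  ∀ u ∈ L, ∀ v ∈ L, symp u v = 0

/-- Lagrangian subspaces: maximal among the isotropic ones. -/
def IsLagrangian {n : ℕ} (L : Submodule (ZMod 2) (Bits n × Bits n)) : Prop :=
  Maximal IsIsotropic L

/-- `ψ` is a stabiliser state (a unit vector, of arbitrary phase) specified by the Lagrangian
subspace `L`: for a basis `v₁, …, vₙ` of `L` and bits `l₁, …, lₙ`, it satisfies
`(-1)^(lⱼ) W(vⱼ) ψ = ψ` for all `j`. -/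
def IsStabiliserStateOf {n : ℕ} (L : Submodule (ZMod 2) (Bits n × Bits n)) (ψ : Vec n) : Prop :=
  IsLagrangian L ∧ ∑ z, ‖ψ z‖ ^ 2 = 1 ∧
    ∃ (v : Basis (Fin n) (ZMod 2) L) (l : Fin n → ZMod 2),
      ∀ j, ((-1 : ℂ) ^ (l j).val) • (pauliW (v j : Bits n × Bits n) *ᵥ ψ) = ψ

/-- Stabiliser states, of arbitrary phase. -/
def IsStabiliserState {n : ℕ} (ψ : Vec n) : Prop :=
  ∃ L : Submodule (ZMod 2) (Bits n × Bits n), IsStabiliserStateOf L ψ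

/-- The integer with binary expansion `z₁ z₂ … zₙ` (`z₁` is the most significant bit). -/
def binaryValue {n : ℕ} (z : Bits n) : ℕ := ∑ j, (z j).val * 2 ^ (Fin.rev j : ℕ)

/-- The first nonzero amplitude, in the order of binary integers, is real and positive. -/
def IsPhaseNormalised {n : ℕ} (ψ : Vec n) : Prop :=
  ∃ z, (0 < (ψ z).re ∧ (ψ z).im = 0) ∧ ∀ w, binaryValue w < binaryValue z → ψ w = 0

/-- The set `𝒮` of `n`-qubit stabiliser states with normalised phase. -/
def states (n : ℕ) : Set (Vec n) := {ψ | IsStabiliserState ψ ∧ IsPhaseNormalised ψ}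

/-- The set `𝒮_N` of noncomputational stabiliser states with normalised phase. -/
def noncomputational (n : ℕ) : Set (states n) := {s | ∀ z : Bits n, (s : Vec n) ≠ ket z}

/-- The number of computational basis states on which `ψ` has a nonzero amplitude. -/
noncomputable def supportSize {n : ℕ} (ψ : Vec n) : ℕ := {z | ψ z ≠ 0}.ncard

/-- The space `ℒₙ` of linear dependencies: the formal linear combinations `α` of the members of
`𝒮` with `∑ α(s) s = 0`. -/
noncomputable def dependencies (n : ℕ) : Submodule ℂ (states n →₀ ℂ) :=
  LinearMap.ker (Finsupp.linearCombination ℂ (fun s : states n => (s : Vec n)))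

/-- `s = 2^(-1/2) (t₁ + t₂)`, where `t₁, t₂` are stabiliser states (of arbitrary phase) that are
specified by a common Lagrangian subspace and have supports of half the size of that of `s`. -/
def IsSplitting {n : ℕ} (s t₁ t₂ : Vec n) : Prop :=
  (∃ L : Submodule (ZMod 2) (Bits n × Bits n),
    IsStabiliserStateOf L t₁ ∧ IsStabiliserStateOf L t₂) ∧
  (∃ r : ℕ, supportSize s = 2 ^ (r + 1) ∧ supportSize t₁ = 2 ^ r ∧ supportSize t₂ = 2 ^ r) ∧
  s = ((√2 : ℝ) : ℂ)⁻¹ • (t₁ + t₂)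

/-- `d` is a possible `D_s`: for some splitting `s = 2^(-1/2) (t₁ + t₂)` and `τ₁, τ₂ ∈ ℂ` with
`τⱼ tⱼ ∈ 𝒮`, it is the formal linear combination with `d(s) = 1`, `d(τⱼ tⱼ) = -2^(-1/2) τⱼ⁻¹`
and value 0 elsewhere. -/
def IsSplittingDependency {n : ℕ} (s : states n) (d : states n →₀ ℂ) : Prop :=
  ∃ (t₁ t₂ : Vec n) (τ₁ τ₂ : ℂ) (h₁ : τ₁ • t₁ ∈ states n) (h₂ : τ₂ • t₂ ∈ states n),
    IsSplitting (s : Vec n) t₁ t₂ ∧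
    d s = 1 ∧
    d ⟨τ₁ • t₁, h₁⟩ = -(((√2 : ℝ) : ℂ)⁻¹ * τ₁⁻¹) ∧
    d ⟨τ₂ • t₂, h₂⟩ = -(((√2 : ℝ) : ℂ)⁻¹ * τ₂⁻¹) ∧
    ∀ u : states n, u ≠ s → u ≠ ⟨τ₁ • t₁, h₁⟩ → u ≠ ⟨τ₂ • t₂, h₂⟩ → d u = 0

end Stabiliser

namespace Stabiliser

open Matrix Module

/-! Being specified by a Lagrangian `L` amounts to being a unit vector with `L ≤ eigenSpace ψ`: each
`pauliW v` is an involution, so the eigenvalues are automatically signs. The support of such a state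
is a coset of the projection of `L` to the `X`-parts, its amplitudes have equal modulus there, and
their ratios are fourth roots of unity. Hence finiteness.

If some member of `L` flips bit `j`, it exchanges the parts of the state with bit `j` equal to 0 and
to 1. Scaled by √2, these parts are stabiliser states for `measured L j`, each with half the
support. Such a `j` exists unless the phase-normalised state is a ket, so splittings exist
(`exists_isSplitting`).

A splitting dependency has coefficient 1 at `s` and otherwise involves only states of smaller
support, so any choice of these is unitriangular and independent. Conversely, a dependency vanishing
on the noncomputational states is a relation among kets, hence zero. This bounds the dimension by
the number of noncomputational states, and `exists_basis_of_triangular` concludes without counting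
states. -/

/-! ### Pauli operators and their eigenvectors -/

/-- The character `a ↦ (-1)^a` of `ℤ₂`. -/
noncomputable def sgn (a : ZMod 2) : ℂ := (-1) ^ a.val

lemma sgn_natCast (k : ℕ) : sgn (k : ZMod 2) = (-1) ^ k := by
  rw [sgn, ZMod.val_natCast, ← neg_one_pow_eq_pow_mod_two]

lemma sgn_zero : sgn 0 = 1 := by simp [sgn]

lemma sgn_add (a b : ZMod 2) : sgn (a + b) = sgn a * sgn b := by
  obtain ⟨k, rfl⟩ := ZMod.natCast_zmod_surjective a
  obtain ⟨m, rfl⟩ := ZMod.natCast_zmod_surjective b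
  rw [← Nat.cast_add, sgn_natCast, sgn_natCast, sgn_natCast, pow_add]

lemma sgn_mul_self (a : ZMod 2) : sgn a * sgn a = 1 := by
  rw [← sgn_add, CharTwo.add_self_eq_zero, sgn_zero]

lemma eq_zero_of_sgn_eq_one {a : ZMod 2} (h : sgn a = 1) : a = 0 := by
  fin_cases a
  · rfl
  · norm_num [sgn, ZMod.val] at h

lemma exists_sgn_of_sq_eq_one {c : ℂ} (h : c * c = 1) : ∃ l, sgn l = c := by
  rcases mul_self_eq_one_iff.mp h with rfl | rfl
  · exact ⟨0, sgn_zero⟩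
  · exact ⟨1, by simp [sgn, ZMod.val_one]⟩

lemma neg_I_pow_mul_self (k : ℕ) : (-Complex.I) ^ k * (-Complex.I) ^ k = (-1) ^ k := by
  rw [← mul_pow]; simp

variable {n : ℕ}

lemma bits_add_self (q : Bits n) : q + q = 0 := by
  funext i; exact CharTwo.add_self_eq_zero _

lemma bits_add_add_cancel (w q : Bits n) : w + q + q = w := by
  rw [add_assoc, bits_add_self, add_zero]

lemma pauliX_mulVec (q : Bits n) (ψ : Vec n) (w : Bits n) : (pauliX q *ᵥ ψ) w = ψ (w + q) := by
  have h : ∀ z : Bits n, (w = z + q) ↔ (z = w + q) := fun z =>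
    ⟨fun h => by rw [h, bits_add_add_cancel], fun h => by rw [h, bits_add_add_cancel]⟩
  simp [pauliX, mulVec, dotProduct, h]

/-- The exponent of `-i` in `pauliW v`. -/
def pauliExponent (v : Bits n × Bits n) : ℕ := ∑ j, (v.1 j).val * (v.2 j).val

lemma sgn_dotProduct_self (v : Bits n × Bits n) :
    sgn (v.2 ⬝ᵥ v.1) = (-1) ^ pauliExponent v := by
  rw [← sgn_natCast]
  congr 1
  simp [pauliExponent, dotProduct, mul_comm]

lemma pauliW_mulVec (v : Bits n × Bits n) (ψ : Vec n) (w : Bits n) :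
    (pauliW v *ᵥ ψ) w =
      (-Complex.I) ^ pauliExponent v * (sgn (w ⬝ᵥ v.1) * ψ (w + v.2)) := by
  rw [pauliW, smul_mulVec, Pi.smul_apply, smul_eq_mul, ← mulVec_mulVec, pauliZ,
    mulVec_diagonal, pauliX_mulVec]
  rfl

/-- The phase `(-i)^(p·q)` squares to `(-1)^(p·q)`, which cancels the sign from commuting `X^q` past
`Z^p`. -/
lemma pauliW_mulVec_self (v : Bits n × Bits n) (ψ : Vec n) :
    pauliW v *ᵥ (pauliW v *ᵥ ψ) = ψ := by
  funext w
  have hs : ((-1 : ℂ) ^ pauliExponent v) ^ 2 = 1 := by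
    rw [← pow_mul, mul_comm, pow_mul]; simp
  rw [pauliW_mulVec, pauliW_mulVec, bits_add_add_cancel, add_dotProduct, sgn_add,
    sgn_dotProduct_self]
  linear_combination (sgn (w ⬝ᵥ v.1) * sgn (w ⬝ᵥ v.1) * (-1) ^ pauliExponent v * ψ w) *
    neg_I_pow_mul_self (pauliExponent v) + (((-1 : ℂ) ^ pauliExponent v) ^ 2 * ψ w) *
    sgn_mul_self (w ⬝ᵥ v.1) + ψ w * hs

/-- The `v` for which `ψ` is an eigenvector of `pauliW v` (or zero). -/
noncomputable def eigenSpace (ψ : Vec n) : Submodule (ZMod 2) (Bits n × Bits n) where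
  carrier := {v | ∃ c : ℂ, ∀ w, sgn (w ⬝ᵥ v.1) * ψ (w + v.2) = c * ψ w}
  zero_mem' := ⟨1, by simp [sgn_zero]⟩
  add_mem' := by
    rintro u v ⟨c, hc⟩ ⟨d, hd⟩
    -- The sign arises because the relation for `v` is applied at the shifted point `w + u.2`.
    refine ⟨sgn (u.2 ⬝ᵥ v.1) * c * d, fun w => ?_⟩
    have h := hd (w + u.2)
    rw [add_dotProduct, sgn_add] at h
    rw [Prod.fst_add, Prod.snd_add, dotProduct_add, sgn_add, ← add_assoc]
    linear_combination (sgn (w ⬝ᵥ u.1) * sgn (u.2 ⬝ᵥ v.1)) * h +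
      d * sgn (u.2 ⬝ᵥ v.1) * hc w -
      (sgn (w ⬝ᵥ u.1) * sgn (w ⬝ᵥ v.1) * ψ (w + u.2 + v.2)) * sgn_mul_self (u.2 ⬝ᵥ v.1)
  smul_mem' := by
    intro a v hv
    rcases (by decide : ∀ a : ZMod 2, a = 0 ∨ a = 1) a with rfl | rfl
    · exact ⟨1, by simp [sgn_zero]⟩
    · rwa [one_smul]

lemma mem_eigenSpace_of_smul_mulVec {ψ : Vec n} {v : Bits n × Bits n} {l : ZMod 2}
    (h : ((-1 : ℂ) ^ l.val) • (pauliW v *ᵥ ψ) = ψ) : v ∈ eigenSpace ψ := by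
  refine ⟨((-Complex.I) ^ pauliExponent v)⁻¹ * sgn l, fun w => ?_⟩
  have h' : sgn l * ((-Complex.I) ^ pauliExponent v * (sgn (w ⬝ᵥ v.1) * ψ (w + v.2))) = ψ w := by
    have := congrFun h w
    rwa [Pi.smul_apply, pauliW_mulVec] at this
  have hI : (-Complex.I) ^ pauliExponent v ≠ 0 := pow_ne_zero _ (by simp)
  rw [← h']
  field_simp
  linear_combination -(sgn (w ⬝ᵥ v.1) * ψ (w + v.2)) * sgn_mul_self l

/-- An eigenvalue of an involution on a nonzero vector is ±1, so the unrestricted scalar in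
`eigenSpace` costs nothing. -/
lemma exists_smul_mulVec_of_mem_eigenSpace {ψ : Vec n} (hψ : ψ ≠ 0) {v : Bits n × Bits n}
    (h : v ∈ eigenSpace ψ) : ∃ l : ZMod 2, ((-1 : ℂ) ^ l.val) • (pauliW v *ᵥ ψ) = ψ := by
  obtain ⟨c, hc⟩ := h
  have hW : pauliW v *ᵥ ψ = ((-Complex.I) ^ pauliExponent v * c) • ψ := by
    funext w
    rw [pauliW_mulVec, hc, Pi.smul_apply, smul_eq_mul, mul_assoc]
  set d := (-Complex.I) ^ pauliExponent v * c
  have hd : d * d = 1 := by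
    have h2 := pauliW_mulVec_self v ψ
    rw [hW, mulVec_smul, hW, smul_smul] at h2
    exact smul_left_injective ℂ hψ (h2.trans (one_smul ℂ ψ).symm)
  obtain ⟨l, hl⟩ := exists_sgn_of_sq_eq_one hd
  refine ⟨l, ?_⟩
  rw [hW, smul_smul, show (-1 : ℂ) ^ l.val = d from hl, hd, one_smul]

lemma exists_pow_four_eq_one_apply_add {ψ : Vec n} (hψ : ψ ≠ 0) {v : Bits n × Bits n}
    (h : v ∈ eigenSpace ψ) (w : Bits n) : ∃ x : ℂ, x ^ 4 = 1 ∧ ψ (w + v.2) = x * ψ w := by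
  obtain ⟨l, hl⟩ := exists_smul_mulVec_of_mem_eigenSpace hψ h
  have h' : sgn l * ((-Complex.I) ^ pauliExponent v * (sgn (w ⬝ᵥ v.1) * ψ (w + v.2))) = ψ w := by
    have := congrFun hl w
    rwa [Pi.smul_apply, pauliW_mulVec] at this
  set y := sgn l * (-Complex.I) ^ pauliExponent v * sgn (w ⬝ᵥ v.1) with hy
  have hs : ∀ a, sgn a ^ 4 = 1 := fun a => by
    linear_combination (sgn a * sgn a + 1) * sgn_mul_self a
  have hy4 : y ^ 4 = 1 := by
    rw [hy, mul_pow, mul_pow, hs, hs, ← pow_mul, mul_comm _ 4, pow_mul, neg_pow]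
    norm_num
  -- Since `y ^ 4 = 1`, this is the inverse of `y`.
  refine ⟨y ^ 3, ?_, ?_⟩
  · rw [← pow_mul, mul_comm, pow_mul, hy4, one_pow]
  · linear_combination y ^ 3 * h' - ψ (w + v.2) * hy4

/-! ### The symplectic form -/

/-- The symplectic product as a bilinear form. -/
def sympForm (n : ℕ) : LinearMap.BilinForm (ZMod 2) (Bits n × Bits n) :=
  LinearMap.mk₂ (ZMod 2) symp
    (fun u v w => by simp only [symp, Prod.fst_add, Prod.snd_add, add_dotProduct,
      dotProduct_add]; ring)
    (fun c u v => by simp only [symp, Prod.smul_fst, Prod.smul_snd, smul_dotProduct,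
      dotProduct_smul, smul_eq_mul]; ring)
    (fun u v w => by simp only [symp, Prod.fst_add, Prod.snd_add, add_dotProduct,
      dotProduct_add]; ring)
    (fun c u v => by simp only [symp, Prod.smul_fst, Prod.smul_snd, smul_dotProduct,
      dotProduct_smul, smul_eq_mul]; ring)

lemma sympForm_apply (u v : Bits n × Bits n) : sympForm n u v = symp u v := rfl

lemma symp_self (u : Bits n × Bits n) : symp u u = 0 := sub_self _

lemma symp_comm (u v : Bits n × Bits n) : symp u v = symp v u := by
  rw [symp, symp, CharTwo.sub_eq_add, CharTwo.sub_eq_add, add_comm]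

lemma sympForm_isRefl : (sympForm n).IsRefl := fun u v h => by
  rwa [sympForm_apply, symp_comm]

lemma sympForm_nondegenerate : (sympForm n).Nondegenerate := by
  refine (sympForm_isRefl.nondegenerate_iff_separatingLeft).mpr fun u hu => ?_
  refine Prod.ext (funext fun j => ?_) (funext fun j => ?_)
  · simpa [sympForm_apply, symp] using hu (0, Pi.single j 1)
  · simpa [sympForm_apply, symp] using hu (Pi.single j 1, 0)

lemma IsIsotropic.sup_span {L : Submodule (ZMod 2) (Bits n × Bits n)} (hL : IsIsotropic L)
    {u : Bits n × Bits n} (hu : ∀ v ∈ L, symp u v = 0) :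
    IsIsotropic (L ⊔ Submodule.span (ZMod 2) {u}) := by
  intro x hx y hy
  obtain ⟨a, ha, b, hb, rfl⟩ := Submodule.mem_sup.mp hx
  obtain ⟨c, hc, d, hd, rfl⟩ := Submodule.mem_sup.mp hy
  obtain ⟨k, rfl⟩ := Submodule.mem_span_singleton.mp hb
  obtain ⟨m, rfl⟩ := Submodule.mem_span_singleton.mp hd
  have h1 := hL a ha c hc
  have h2 := hu c hc
  have h3 := hu a ha
  rw [symp_comm] at h3
  have h4 := symp_self u
  simp only [← sympForm_apply] at *
  simp [h1, h2, h3, h4]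

/-- A vector orthogonal to `L` is also orthogonal to itself, so adjoining it keeps `L` isotropic;
maximality puts it in `L`. -/
lemma isLagrangian_iff {L : Submodule (ZMod 2) (Bits n × Bits n)} :
    IsLagrangian L ↔ IsIsotropic L ∧ ∀ u, (∀ v ∈ L, symp u v = 0) → u ∈ L := by
  constructor
  · refine fun h => ⟨h.1, fun u hu => ?_⟩
    exact h.2 (h.1.sup_span hu) le_sup_left
      (Submodule.mem_sup_right (Submodule.mem_span_singleton_self u))
  · exact fun h => ⟨h.1, fun M hM hLM u hu => h.2 u fun v hv => hM u hu v (hLM hv)⟩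

/-- `L` is its own orthogonal complement for a nondegenerate form in dimension `2n`. -/
lemma IsLagrangian.finrank_eq {L : Submodule (ZMod 2) (Bits n × Bits n)} (hL : IsLagrangian L) :
    finrank (ZMod 2) L = n := by
  have h := isLagrangian_iff.mp hL
  have ho : (sympForm n).orthogonal L = L := by
    ext u
    constructor
    · intro hu
      refine h.2 u fun v hv => ?_
      rw [symp_comm]
      exact hu v hv
    · exact fun hu v hv => h.1 v hv u hu
  have hf := LinearMap.BilinForm.finrank_orthogonal sympForm_nondegenerate L
  have hle := Submodule.finrank_le L
  rw [ho] at hf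
  have h2 : finrank (ZMod 2) (Bits n × Bits n) = n + n := by simp
  omega

/-! ### The support of a stabiliser state -/

lemma ne_zero_of_sum_norm_sq {ψ : Vec n} (h : ∑ z, ‖ψ z‖ ^ 2 = 1) : ψ ≠ 0 := by
  rintro rfl
  simp at h

lemma IsStabiliserStateOf.ne_zero {L : Submodule (ZMod 2) (Bits n × Bits n)} {ψ : Vec n}
    (h : IsStabiliserStateOf L ψ) : ψ ≠ 0 := ne_zero_of_sum_norm_sq h.2.1

lemma IsStabiliserStateOf.le_eigenSpace {L : Submodule (ZMod 2) (Bits n × Bits n)} {ψ : Vec n}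
    (h : IsStabiliserStateOf L ψ) : L ≤ eigenSpace ψ := by
  obtain ⟨-, -, v, l, hv⟩ := h
  intro x hx
  have hs : (⟨x, hx⟩ : L) ∈ (eigenSpace ψ).comap L.subtype := by
    have : Submodule.span (ZMod 2) (Set.range v) ≤ (eigenSpace ψ).comap L.subtype := by
      rw [Submodule.span_le]
      rintro _ ⟨j, rfl⟩
      exact mem_eigenSpace_of_smul_mulVec (hv j)
    exact this (v.span_eq ▸ Submodule.mem_top)
  exact hs

lemma isStabiliserStateOf_of_le_eigenSpace {L : Submodule (ZMod 2) (Bits n × Bits n)} {ψ : Vec n}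
    (hL : IsLagrangian L) (h1 : ∑ z, ‖ψ z‖ ^ 2 = 1) (h : L ≤ eigenSpace ψ) :
    IsStabiliserStateOf L ψ := by
  let v := finBasisOfFinrankEq (ZMod 2) L hL.finrank_eq
  choose l hl using fun j => exists_smul_mulVec_of_mem_eigenSpace
    (ne_zero_of_sum_norm_sq h1) (h (v j).2)
  exact ⟨hL, h1, v, l, hl⟩

/-- Any two positions in the support of a stabiliser state differ by the `X`-part of a member of
the Lagrangian subspace. -/
lemma IsStabiliserStateOf.exists_add_eq {L : Submodule (ZMod 2) (Bits n × Bits n)} {ψ : Vec n}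
    (h : IsStabiliserStateOf L ψ) {z w : Bits n} (hz : ψ z ≠ 0) (hw : ψ w ≠ 0) :
    ∃ v ∈ L, w = z + v.2 := by
  have hL := isLagrangian_iff.mp h.1
  suffices hQ : w - z ∈ L.map (LinearMap.snd (ZMod 2) (Bits n) (Bits n)) by
    obtain ⟨v, hv, hv2⟩ := hQ
    exact ⟨v, hv, by rw [← LinearMap.snd_apply (R := ZMod 2), hv2]; abel⟩
  -- Otherwise a functional `p` kills all `X`-parts of `L` but not `w - z`. Then `(p, 0)` is
  -- orthogonal to `L`, so it lies in `L`, and the diagonal operator `Z^p` must have the same sign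
  -- at `z` and `w`.
  by_contra hQ
  obtain ⟨f, hf, hfQ⟩ := Submodule.exists_dual_map_eq_bot_of_notMem hQ inferInstance
  obtain ⟨p, rfl⟩ := (dotProductEquiv (ZMod 2) (Fin n)).surjective f
  have hp : ((p, 0) : Bits n × Bits n) ∈ L := by
    refine hL.2 _ fun v hv => ?_
    have : dotProductEquiv (ZMod 2) (Fin n) p v.2 ∈
        Submodule.map (dotProductEquiv (ZMod 2) (Fin n) p)
          (L.map (LinearMap.snd (ZMod 2) (Bits n) (Bits n))) :=
      Submodule.mem_map_of_mem (Submodule.mem_map_of_mem (f := LinearMap.snd _ _ _) hv)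
    rw [hfQ, Submodule.mem_bot] at this
    simpa [symp] using this
  obtain ⟨c, hc⟩ := h.le_eigenSpace hp
  have hcz := hc z
  have hcw := hc w
  simp only [add_zero] at hcz hcw
  have e1 := mul_right_cancel₀ hz hcz
  have e2 := mul_right_cancel₀ hw hcw
  refine hf (eq_zero_of_sgn_eq_one ?_)
  rw [dotProductEquiv_apply_apply, dotProduct_comm, sub_dotProduct, CharTwo.sub_eq_add, sgn_add,
    e1, e2, ← e1, sgn_mul_self]

lemma norm_apply_add {ψ : Vec n} (hψ : ψ ≠ 0) {v : Bits n × Bits n}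
    (h : v ∈ eigenSpace ψ) (w : Bits n) : ‖ψ (w + v.2)‖ = ‖ψ w‖ := by
  obtain ⟨x, hx, hw⟩ := exists_pow_four_eq_one_apply_add hψ h w
  rw [hw, norm_mul, Complex.norm_eq_one_of_pow_eq_one hx (by norm_num), one_mul]

lemma IsStabiliserStateOf.support_eq {L : Submodule (ZMod 2) (Bits n × Bits n)} {ψ : Vec n}
    (h : IsStabiliserStateOf L ψ) {z : Bits n} (hz : ψ z ≠ 0) :
    {w | ψ w ≠ 0} =
      (z + ·) '' (L.map (LinearMap.snd (ZMod 2) (Bits n) (Bits n)) : Set (Bits n)) := by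
  ext w
  constructor
  · intro hw
    obtain ⟨v, hv, rfl⟩ := h.exists_add_eq hz hw
    exact ⟨v.2, ⟨v, hv, rfl⟩, rfl⟩
  · rintro ⟨_, ⟨v, hv, rfl⟩, rfl⟩
    change ψ (z + v.2) ≠ 0
    rwa [← norm_ne_zero_iff, norm_apply_add h.ne_zero (h.le_eigenSpace hv), norm_ne_zero_iff]

lemma IsStabiliserStateOf.supportSize_eq {L : Submodule (ZMod 2) (Bits n × Bits n)} {ψ : Vec n}
    (h : IsStabiliserStateOf L ψ) : supportSize ψ =
      2 ^ finrank (ZMod 2) (L.map (LinearMap.snd (ZMod 2) (Bits n) (Bits n))) := by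
  obtain ⟨z, hz⟩ := Function.ne_iff.mp h.ne_zero
  rw [supportSize, h.support_eq hz, Set.ncard_image_of_injective _ (add_right_injective z),
    ← Nat.card_coe_set_eq]
  have := Module.natCard_eq_pow_finrank (K := ZMod 2)
    (V := L.map (LinearMap.snd (ZMod 2) (Bits n) (Bits n)))
  rwa [Nat.card_zmod] at this

/-! ### Finiteness -/

/-- The numbers `x / √m` with `x ^ 4 = 1` and `m ≤ 2 ^ n`, together with zero. -/
def amplitudes (n : ℕ) : Set ℂ :=
  Set.image2 (fun (x : ℂ) (m : ℕ) => x * ((√m : ℝ) : ℂ)⁻¹) {x | x ^ 4 = 1} (Set.Iic (2 ^ n)) ∪ {0}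

lemma finite_amplitudes (n : ℕ) : (amplitudes n).Finite := by
  refine ((Set.Finite.image2 _ ?_ (Set.finite_Iic _))).union (Set.finite_singleton 0)
  refine (Polynomial.nthRootsFinset 4 (1 : ℂ)).finite_toSet.subset fun x hx => ?_
  rw [Finset.mem_coe, Polynomial.mem_nthRootsFinset (by norm_num)]
  exact hx

lemma supportSize_le (ψ : Vec n) : supportSize ψ ≤ 2 ^ n := by
  refine (Set.ncard_le_card _).trans_eq ?_
  simp

lemma sum_norm_sq_eq {ψ : Vec n} {a : ℝ} (h : ∀ w, ψ w ≠ 0 → ‖ψ w‖ = a) :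
    ∑ w, ‖ψ w‖ ^ 2 = supportSize ψ * a ^ 2 := by
  classical
  rw [supportSize, Set.ncard_eq_toFinset_card', ← nsmul_eq_mul, ← Finset.sum_const,
    Set.toFinset_ofPred, Finset.sum_filter]
  refine Finset.sum_congr rfl fun w _ => ?_
  split_ifs with hw
  · rw [h w hw]
  · simp [not_not.mp hw]

/-- The modulus is constant on the support, so the unit norm determines it. -/
lemma norm_apply_of_ne_zero {L : Submodule (ZMod 2) (Bits n × Bits n)} {ψ : Vec n}
    (h : IsStabiliserStateOf L ψ) {z : Bits n} (hz : ψ z ≠ 0) :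
    ‖ψ z‖ = (√(supportSize ψ))⁻¹ := by
  have hc := sum_norm_sq_eq (ψ := ψ) (a := ‖ψ z‖) fun w hw => by
    obtain ⟨v, hv, rfl⟩ := h.exists_add_eq hz hw
    exact norm_apply_add h.ne_zero (h.le_eigenSpace hv) z
  rw [h.2.1] at hc
  have h0 : (0 : ℝ) < supportSize ψ := by
    rw [h.supportSize_eq]; positivity
  rw [← Real.sqrt_inv, eq_comm, Real.sqrt_eq_iff_mul_self_eq (by positivity) (norm_nonneg _)]
  field_simp
  linarith

lemma eq_norm_of_re_pos {x : ℂ} (h : 0 < x.re ∧ x.im = 0) : x = (‖x‖ : ℂ) := by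
  have hx : x = (x.re : ℂ) := Complex.ext rfl (by simp [h.2])
  rw [hx, Complex.norm_real, Real.norm_of_nonneg h.1.le]

lemma ne_zero_of_re_pos {x : ℂ} (h : 0 < x.re) : x ≠ 0 := by
  rintro rfl
  simp at h

/-- Phase normalisation makes one amplitude equal to its modulus; every other nonzero amplitude is a
fourth root of unity times it. -/
lemma finite_states (n : ℕ) : (states n).Finite := by
  refine (Set.Finite.pi' fun _ : Bits n => finite_amplitudes n).subset ?_
  rintro ψ ⟨⟨L, hL⟩, z, hz, -⟩ w
  by_cases hw : ψ w = 0
  · exact Or.inr hw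
  have hz0 : ψ z ≠ 0 := ne_zero_of_re_pos hz.1
  obtain ⟨v, hv, rfl⟩ := hL.exists_add_eq hz0 hw
  obtain ⟨x, hx, hxw⟩ := exists_pow_four_eq_one_apply_add hL.ne_zero (hL.le_eigenSpace hv) z
  refine Or.inl ⟨x, hx, supportSize ψ, supportSize_le ψ, ?_⟩
  rw [hxw, eq_norm_of_re_pos hz, norm_apply_of_ne_zero hL hz0, Complex.ofReal_inv]

/-! ### Phases -/

lemma eigenSpace_le_smul (τ : ℂ) (ψ : Vec n) : eigenSpace ψ ≤ eigenSpace (τ • ψ) := by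
  rintro v ⟨c, hc⟩
  refine ⟨c, fun w => ?_⟩
  simp only [Pi.smul_apply, smul_eq_mul]
  linear_combination τ * hc w

lemma IsStabiliserStateOf.smul {L : Submodule (ZMod 2) (Bits n × Bits n)} {ψ : Vec n}
    (h : IsStabiliserStateOf L ψ) {τ : ℂ} (hτ : ‖τ‖ = 1) : IsStabiliserStateOf L (τ • ψ) :=
  isStabiliserStateOf_of_le_eigenSpace h.1 (by simpa [hτ] using h.2.1)
    (h.le_eigenSpace.trans (eigenSpace_le_smul τ ψ))

lemma IsStabiliserState.exists_smul_mem_states {ψ : Vec n} (h : IsStabiliserState ψ) :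
    ∃ τ : ℂ, τ • ψ ∈ states n := by
  obtain ⟨L, hL⟩ := h
  obtain ⟨z₀, hz₀⟩ := Function.ne_iff.mp hL.ne_zero
  obtain ⟨z, hz, hmin⟩ := Set.exists_min_image {z | ψ z ≠ 0} binaryValue (Set.toFinite _) ⟨z₀, hz₀⟩
  have hz' : (0 : ℝ) < ‖ψ z‖ := norm_pos_iff.mpr hz
  have hmul : starRingEnd ℂ (ψ z) / ‖ψ z‖ * ψ z = (‖ψ z‖ : ℂ) := by
    rw [div_mul_eq_mul_div, Complex.conj_mul', sq, mul_div_cancel_right₀]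
    exact_mod_cast hz'.ne'
  refine ⟨starRingEnd ℂ (ψ z) / ‖ψ z‖, ⟨L, hL.smul ?_⟩, z, ?_, fun w hw => ?_⟩
  · rw [norm_div, RCLike.norm_conj, Complex.norm_real, norm_norm, div_self hz'.ne']
  · rw [Pi.smul_apply, smul_eq_mul, hmul]
    exact ⟨hz', Complex.ofReal_im _⟩
  · by_contra hne
    exact absurd (hmin w fun h0 => hne (by simp [h0])) (not_le.mpr hw)

/-! ### Splittings -/

/-- If all `X`-parts vanished, the support would be a single point, with amplitude 1 by
normalisation, making the state a ket. -/
lemma exists_snd_apply_eq_one {L : Submodule (ZMod 2) (Bits n × Bits n)} {ψ : Vec n}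
    (h : IsStabiliserStateOf L ψ) (hψ : IsPhaseNormalised ψ) (hne : ∀ z, ψ ≠ ket z) :
    ∃ v ∈ L, ∃ j, v.2 j = 1 := by
  by_contra! hall
  have hv : ∀ v ∈ L, v.2 = 0 := fun v hv => funext fun j =>
    ((by decide : ∀ a : ZMod 2, a ≠ 1 → a = 0) _ (hall v hv j))
  obtain ⟨z, hz, -⟩ := hψ
  have hz0 : ψ z ≠ 0 := ne_zero_of_re_pos hz.1
  have hsupp : ∀ w, w ≠ z → ψ w = 0 := fun w hwz => by
    by_contra hw
    obtain ⟨v, hvL, rfl⟩ := h.exists_add_eq hz0 hw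
    exact hwz (by rw [hv v hvL, add_zero])
  refine hne z (funext fun w => ?_)
  by_cases hwz : w = z
  · subst hwz
    have h1 := h.2.1
    rw [Finset.sum_eq_single w (fun b _ hb => by simp [hsupp b hb]) (by simp)] at h1
    rw [ket, Pi.single_eq_same, eq_norm_of_re_pos hz, (pow_eq_one_iff_of_nonneg
      (norm_nonneg _) two_ne_zero).mp h1, Complex.ofReal_one]
  · rw [hsupp w hwz, ket, Pi.single_eq_of_ne hwz]

/-- The Lagrangian subspace after a measurement of the `j`-th bit. -/
def measured (L : Submodule (ZMod 2) (Bits n × Bits n)) (j : Fin n) :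
    Submodule (ZMod 2) (Bits n × Bits n) :=
  (L ⊓ LinearMap.ker (LinearMap.proj j ∘ₗ LinearMap.snd (ZMod 2) (Bits n) (Bits n))) ⊔
    Submodule.span (ZMod 2) {(Pi.single j 1, 0)}

lemma symp_single (j : Fin n) (v : Bits n × Bits n) :
    symp (Pi.single j 1, 0) v = v.2 j := by simp [symp]

lemma mem_inf_ker {L : Submodule (ZMod 2) (Bits n × Bits n)} {j : Fin n} {v : Bits n × Bits n} :
    v ∈ L ⊓ LinearMap.ker (LinearMap.proj j ∘ₗ LinearMap.snd (ZMod 2) (Bits n) (Bits n)) ↔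
      v ∈ L ∧ v.2 j = 0 := Iff.rfl

lemma isLagrangian_measured {L : Submodule (ZMod 2) (Bits n × Bits n)} (hL : IsLagrangian L)
    {j : Fin n} {v₁ : Bits n × Bits n} (hv₁ : v₁ ∈ L) (hj : v₁.2 j = 1) :
    IsLagrangian (measured L j) := by
  have h := isLagrangian_iff.mp hL
  refine isLagrangian_iff.mpr ⟨IsIsotropic.sup_span ?_ ?_, fun u hu => ?_⟩
  · exact fun u hu v hv => h.1 u (mem_inf_ker.mp hu).1 v (mem_inf_ker.mp hv).1
  · intro v hv
    rw [symp_single]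
    exact (mem_inf_ker.mp hv).2
  · have huj : u.2 j = 0 := by
      rw [← symp_single, symp_comm]
      exact hu _ (Submodule.mem_sup_right (Submodule.mem_span_singleton_self _))
    set e : Bits n × Bits n := (Pi.single j 1, 0)
    -- The members of `L` with `j`-th bit 0, together with `v₁`, span `L`. Since `u` is orthogonal
    -- to the former and `symp e v₁ = 1`, this correction makes `u` orthogonal to all of `L`.
    have hmem : u - symp u v₁ • e ∈ L := by
      refine h.2 _ fun v hv => ?_
      have h0 : symp u (v - v.2 j • v₁) = 0 := hu _ (Submodule.mem_sup_left
        (mem_inf_ker.mpr ⟨L.sub_mem hv (L.smul_mem _ hv₁), by simp [hj]⟩))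
      have h1 : symp e v = v.2 j := symp_single j v
      rw [← sympForm_apply] at h0 h1 ⊢
      rw [map_sub, map_smul, smul_eq_mul] at h0
      rw [map_sub, map_smul, LinearMap.sub_apply, LinearMap.smul_apply, h1, ← sympForm_apply,
        smul_eq_mul, mul_comm]
      exact h0
    rw [← sub_add_cancel u (symp u v₁ • e)]
    refine Submodule.add_mem_sup (mem_inf_ker.mpr ⟨hmem, ?_⟩)
      (Submodule.smul_mem _ _ (Submodule.mem_span_singleton_self _))
    simp [e, huj]

/-- The part of `ψ` on which the `j`-th bit is `a`, scaled by `√2`. -/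
noncomputable def half (ψ : Vec n) (j : Fin n) (a : ZMod 2) : Vec n :=
  fun z => if z j = a then ((√2 : ℝ) : ℂ) * ψ z else 0

lemma sqrt_two_ne_zero : ((√2 : ℝ) : ℂ) ≠ 0 := by
  exact_mod_cast (Real.sqrt_pos.mpr two_pos).ne'

lemma half_add_half (ψ : Vec n) (j : Fin n) :
    ((√2 : ℝ) : ℂ)⁻¹ • (half ψ j 0 + half ψ j 1) = ψ := by
  funext z
  have h2 := sqrt_two_ne_zero
  rcases (by decide : ∀ a : ZMod 2, a = 0 ∨ a = 1) (z j) with h | h <;>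
    simp [half, h, h2]

/-- Operators that do not flip bit `j` preserve each half and keep their eigenvalue; the new
generator, `Z` on bit `j`, acts on the half as the scalar `sgn a`. -/
lemma measured_le_eigenSpace_half {L : Submodule (ZMod 2) (Bits n × Bits n)} {ψ : Vec n}
    (h : L ≤ eigenSpace ψ) (j : Fin n) (a : ZMod 2) :
    measured L j ≤ eigenSpace (half ψ j a) := by
  refine sup_le (fun v hv => ?_) ?_
  · obtain ⟨hvL, hvj⟩ := mem_inf_ker.mp hv
    obtain ⟨c, hc⟩ := h hvL
    refine ⟨c, fun w => ?_⟩
    have hwj : (w + v.2) j = w j := by rw [Pi.add_apply, hvj, add_zero]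
    simp only [half, hwj]
    split_ifs
    · linear_combination ((√2 : ℝ) : ℂ) * hc w
    · simp
  · rw [Submodule.span_singleton_le_iff_mem]
    refine ⟨sgn a, fun w => ?_⟩
    by_cases hw : w j = a <;> simp [half, hw]

/-- Translation by `v.2` flips bit `j`, so it exchanges the halves; hence they have equal norms and
equal support sizes. -/
lemma norm_half_add {ψ : Vec n} (hψ : ψ ≠ 0) {v : Bits n × Bits n} (h : v ∈ eigenSpace ψ)
    {j : Fin n} (hj : v.2 j = 1) (a : ZMod 2) (w : Bits n) :
    ‖half ψ j (a + 1) (w + v.2)‖ = ‖half ψ j a w‖ := by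
  simp only [half, Pi.add_apply, hj, add_left_inj]
  split_ifs
  · rw [norm_mul, norm_mul, norm_apply_add hψ h]
  · rfl

lemma sum_norm_sq_half {ψ : Vec n} (h1 : ∑ z, ‖ψ z‖ ^ 2 = 1) {v : Bits n × Bits n}
    (h : v ∈ eigenSpace ψ) {j : Fin n} (hj : v.2 j = 1) (a : ZMod 2) :
    ∑ z, ‖half ψ j a z‖ ^ 2 = 1 := by
  have hψ := ne_zero_of_sum_norm_sq h1
  have hswap : ∀ b, ∑ z, ‖half ψ j b z‖ ^ 2 = ∑ z, ‖half ψ j (b + 1) z‖ ^ 2 := fun b => by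
    rw [← Equiv.sum_comp (Equiv.addRight v.2) fun z => ‖half ψ j (b + 1) z‖ ^ 2]
    exact Finset.sum_congr rfl fun z _ => by
      rw [Equiv.coe_addRight, norm_half_add hψ h hj]
  have hsum : ∑ z, ‖half ψ j 0 z‖ ^ 2 + ∑ z, ‖half ψ j 1 z‖ ^ 2 = 2 := by
    rw [← Finset.sum_add_distrib, ← mul_one (2 : ℝ), ← h1, Finset.mul_sum]
    refine Finset.sum_congr rfl fun z _ => ?_
    rcases (by decide : ∀ a : ZMod 2, a = 0 ∨ a = 1) (z j) with h | h <;>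
      simp [half, h, mul_pow]
  have h01 := hswap 0
  rw [zero_add] at h01
  rcases (by decide : ∀ a : ZMod 2, a = 0 ∨ a = 1) a with rfl | rfl <;> linarith

lemma supportSize_half_add_half (ψ : Vec n) (j : Fin n) :
    supportSize (half ψ j 0) + supportSize (half ψ j 1) = supportSize ψ := by
  rw [supportSize, supportSize, supportSize, ← Set.ncard_union_eq]
  · congr 1
    ext z
    rcases (by decide : ∀ a : ZMod 2, a = 0 ∨ a = 1) (z j) with h | h <;>
      simp [half, h]
  · rw [Set.disjoint_left]
    intro z h0 h1
    rcases (by decide : ∀ a : ZMod 2, a = 0 ∨ a = 1) (z j) with h | h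
    · simp [half, h] at h1
    · simp [half, h] at h0

lemma supportSize_half_zero_eq {ψ : Vec n} (hψ : ψ ≠ 0) {v : Bits n × Bits n}
    (h : v ∈ eigenSpace ψ) {j : Fin n} (hj : v.2 j = 1) :
    supportSize (half ψ j 0) = supportSize (half ψ j 1) := by
  rw [supportSize, supportSize, ← Set.ncard_image_of_injective _ (add_left_injective v.2)]
  congr 1
  ext w
  constructor
  · rintro ⟨z, hz, rfl⟩
    have := norm_half_add hψ h hj 0 z
    rw [zero_add] at this
    change half ψ j 1 (z + v.2) ≠ 0
    rwa [← norm_ne_zero_iff, this, norm_ne_zero_iff]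
  · intro hw
    refine ⟨w + v.2, ?_, bits_add_add_cancel w v.2⟩
    have := norm_half_add hψ h hj 1 w
    rw [CharTwo.add_self_eq_zero] at this
    change half ψ j 0 (w + v.2) ≠ 0
    rwa [← norm_ne_zero_iff, this, norm_ne_zero_iff]

lemma exists_isSplitting {ψ : Vec n} (h : IsStabiliserState ψ) (hψ : IsPhaseNormalised ψ)
    (hne : ∀ z, ψ ≠ ket z) : ∃ t₁ t₂, IsSplitting ψ t₁ t₂ := by
  obtain ⟨L, hL⟩ := h
  obtain ⟨v, hv, j, hj⟩ := exists_snd_apply_eq_one hL hψ hne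
  have hLag := isLagrangian_measured hL.1 hv hj
  have hvE := hL.le_eigenSpace hv
  have hstate : ∀ a, IsStabiliserStateOf (measured L j) (half ψ j a) := fun a =>
    isStabiliserStateOf_of_le_eigenSpace hLag (sum_norm_sq_half hL.2.1 hvE hj a)
      (measured_le_eigenSpace_half hL.le_eigenSpace j a)
  have hsum := supportSize_half_add_half ψ j
  have heq := supportSize_half_zero_eq hL.ne_zero hvE hj
  have h0 := (hstate 0).supportSize_eq
  refine ⟨half ψ j 0, half ψ j 1, ⟨measured L j, hstate 0, hstate 1⟩, ⟨_, ?_, h0, heq ▸ h0⟩,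
    (half_add_half ψ j).symm⟩
  rw [← hsum, ← heq, h0, pow_succ, mul_two]

/-! ### Dependencies -/

lemma ne_zero_of_smul_mem_states {τ : ℂ} {ψ : Vec n} (h : τ • ψ ∈ states n) : τ ≠ 0 := by
  rintro rfl
  exact h.1.choose_spec.ne_zero (zero_smul ℂ ψ)

lemma supportSize_smul {τ : ℂ} (hτ : τ ≠ 0) (ψ : Vec n) : supportSize (τ • ψ) = supportSize ψ := by
  simp [supportSize, hτ]

lemma IsSplitting.supportSize_smul_left_lt {s t₁ t₂ : Vec n} (h : IsSplitting s t₁ t₂) {τ : ℂ}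
    (hτ : τ ≠ 0) : supportSize (τ • t₁) < supportSize s := by
  obtain ⟨-, ⟨r, hs, ht, -⟩, -⟩ := h
  rw [supportSize_smul hτ, hs, ht]
  exact Nat.pow_lt_pow_succ (by norm_num)

lemma IsSplitting.supportSize_smul_right_lt {s t₁ t₂ : Vec n} (h : IsSplitting s t₁ t₂) {τ : ℂ}
    (hτ : τ ≠ 0) : supportSize (τ • t₂) < supportSize s := by
  obtain ⟨-, ⟨r, hs, -, ht⟩, -⟩ := h
  rw [supportSize_smul hτ, hs, ht]
  exact Nat.pow_lt_pow_succ (by norm_num)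

/-- If they were equal, `t₂` would be a multiple of `t₁`, and `s` would be supported within the
support of `t₁`, which is too small. Distinctness is what makes the support of the dependency
exactly three. -/
lemma IsSplitting.smul_ne_smul {s t₁ t₂ : Vec n} (h : IsSplitting s t₁ t₂) {τ₁ τ₂ : ℂ}
    (h₂ : τ₂ ≠ 0) : τ₁ • t₁ ≠ τ₂ • t₂ := by
  intro heq
  obtain ⟨-, ⟨r, hs, ht, -⟩, hsum⟩ := h
  have ht₂ : t₂ = (τ₂⁻¹ * τ₁) • t₁ := by rw [mul_smul, heq, inv_smul_smul₀ h₂]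
  have hsub : {z | s z ≠ 0} ⊆ {z | t₁ z ≠ 0} := fun z hz hz1 => hz (by
    rw [hsum, ht₂]
    simp [hz1])
  have := Set.ncard_le_ncard hsub (Set.toFinite _)
  rw [supportSize] at hs ht
  rw [hs, ht, pow_succ] at this
  have := Nat.two_pow_pos r
  omega

/-- A splitting dependency, spelled out as a combination of three distinct states. -/
lemma isSplittingDependency_iff {s : states n} {d : states n →₀ ℂ} :
    IsSplittingDependency s d ↔ ∃ (t₁ t₂ : Vec n) (τ₁ τ₂ : ℂ) (u₁ u₂ : states n),
      (u₁ : Vec n) = τ₁ • t₁ ∧ (u₂ : Vec n) = τ₂ • t₂ ∧ τ₁ ≠ 0 ∧ τ₂ ≠ 0 ∧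
      IsSplitting (s : Vec n) t₁ t₂ ∧
      s ≠ u₁ ∧ s ≠ u₂ ∧ u₁ ≠ u₂ ∧
      supportSize (u₁ : Vec n) < supportSize (s : Vec n) ∧
      supportSize (u₂ : Vec n) < supportSize (s : Vec n) ∧
      d = Finsupp.single s 1 + Finsupp.single u₁ (-(((√2 : ℝ) : ℂ)⁻¹ * τ₁⁻¹)) +
        Finsupp.single u₂ (-(((√2 : ℝ) : ℂ)⁻¹ * τ₂⁻¹)) := by
  classical
  constructor
  · rintro ⟨t₁, t₂, τ₁, τ₂, h₁, h₂, hsp, e0, e1, e2, e3⟩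
    have hτ₁ := ne_zero_of_smul_mem_states h₁
    have hτ₂ := ne_zero_of_smul_mem_states h₂
    have hlt₁ := hsp.supportSize_smul_left_lt hτ₁
    have hlt₂ := hsp.supportSize_smul_right_lt hτ₂
    have hs₁ : s ≠ ⟨τ₁ • t₁, h₁⟩ := fun h => by
      rw [h] at hlt₁; exact lt_irrefl _ hlt₁
    have hs₂ : s ≠ ⟨τ₂ • t₂, h₂⟩ := fun h => by
      rw [h] at hlt₂; exact lt_irrefl _ hlt₂
    have h12 : (⟨τ₁ • t₁, h₁⟩ : states n) ≠ ⟨τ₂ • t₂, h₂⟩ := fun h =>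
      hsp.smul_ne_smul hτ₂ (congrArg Subtype.val h)
    refine ⟨t₁, t₂, τ₁, τ₂, ⟨_, h₁⟩, ⟨_, h₂⟩, rfl, rfl, hτ₁, hτ₂, hsp, hs₁, hs₂, h12,
      hlt₁, hlt₂, ?_⟩
    ext u
    by_cases hu0 : u = s
    · subst hu0; simp [e0, hs₁.symm, hs₂.symm]
    by_cases hu1 : u = ⟨τ₁ • t₁, h₁⟩
    · subst hu1; simp [e1, hs₁, h12.symm]
    by_cases hu2 : u = ⟨τ₂ • t₂, h₂⟩
    · subst hu2; simp [e2, hs₂, h12]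
    rw [e3 u hu0 hu1 hu2]
    simp [Ne.symm hu0, Ne.symm hu1, Ne.symm hu2]
  · rintro ⟨t₁, t₂, τ₁, τ₂, ⟨_, h₁⟩, ⟨_, h₂⟩, rfl, rfl, hτ₁, hτ₂, hsp, hs₁, hs₂, h12, -, -, rfl⟩
    refine ⟨t₁, t₂, τ₁, τ₂, h₁, h₂, hsp, ?_, ?_, ?_, fun u hu0 hu1 hu2 => ?_⟩
    · simp [hs₁.symm, hs₂.symm]
    · simp [hs₁, h12.symm]
    · simp [hs₂, h12]
    · simp [Ne.symm hu0, Ne.symm hu1, Ne.symm hu2]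

lemma exists_isSplittingDependency {s : states n} (hs : s ∈ noncomputational n) :
    ∃ d, IsSplittingDependency s d := by
  classical
  obtain ⟨t₁, t₂, hsp⟩ := exists_isSplitting s.2.1 s.2.2 hs
  obtain ⟨L, hL₁, hL₂⟩ := hsp.1
  obtain ⟨τ₁, h₁⟩ := IsStabiliserState.exists_smul_mem_states ⟨L, hL₁⟩
  obtain ⟨τ₂, h₂⟩ := IsStabiliserState.exists_smul_mem_states ⟨L, hL₂⟩
  have hτ₁ := ne_zero_of_smul_mem_states h₁
  have hτ₂ := ne_zero_of_smul_mem_states h₂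
  have hlt₁ := hsp.supportSize_smul_left_lt hτ₁
  have hlt₂ := hsp.supportSize_smul_right_lt hτ₂
  refine ⟨_, isSplittingDependency_iff.mpr ⟨t₁, t₂, τ₁, τ₂, ⟨_, h₁⟩, ⟨_, h₂⟩, rfl, rfl, hτ₁, hτ₂,
    hsp, ?_, ?_, ?_, hlt₁, hlt₂, rfl⟩⟩
  · intro h
    rw [h] at hlt₁; exact lt_irrefl _ hlt₁
  · intro h
    rw [h] at hlt₂; exact lt_irrefl _ hlt₂
  · exact fun h => hsp.smul_ne_smul hτ₂ (congrArg Subtype.val h)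

lemma IsSplittingDependency.mem_dependencies {s : states n} {d : states n →₀ ℂ}
    (h : IsSplittingDependency s d) : d ∈ dependencies n := by
  obtain ⟨t₁, t₂, τ₁, τ₂, u₁, u₂, hu₁, hu₂, hτ₁, hτ₂, hsp, -, -, -, -, -, rfl⟩ :=
    isSplittingDependency_iff.mp h
  rw [dependencies, LinearMap.mem_ker, map_add, map_add]
  simp only [Finsupp.linearCombination_single]
  rw [hu₁, hu₂, hsp.2.2]
  funext z
  simp
  field_simp
  ring

lemma IsSplittingDependency.card_support {s : states n} {d : states n →₀ ℂ}
    (h : IsSplittingDependency s d) : d.support.card = 3 := by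
  classical
  obtain ⟨t₁, t₂, τ₁, τ₂, u₁, u₂, hu₁, hu₂, hτ₁, hτ₂, hsp, hs₁, hs₂, h12, -, -, rfl⟩ :=
    isSplittingDependency_iff.mp h
  rw [Finset.card_eq_three]
  refine ⟨s, u₁, u₂, hs₁, hs₂, h12, ?_⟩
  have h2 := sqrt_two_ne_zero
  ext u
  rw [Finsupp.mem_support_iff]
  by_cases hu0 : u = s
  · subst hu0; simp [hs₁.symm, hs₂.symm]
  by_cases hu1 : u = u₁
  · subst hu1; simp [hs₁, h12.symm, hτ₁]
  by_cases hu2 : u = u₂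
  · subst hu2; simp [hs₂, h12, hτ₂]
  simp [hu0, hu1, hu2]

lemma IsSplittingDependency.apply_self {s : states n} {d : states n →₀ ℂ}
    (h : IsSplittingDependency s d) : d s = 1 := by
  obtain ⟨-, -, -, -, -, -, -, h, -⟩ := h
  exact h

lemma IsSplittingDependency.supportSize_lt {s u : states n} {d : states n →₀ ℂ}
    (h : IsSplittingDependency s d) (hus : u ≠ s) (hu : d u ≠ 0) :
    supportSize (u : Vec n) < supportSize (s : Vec n) := by
  classical
  obtain ⟨t₁, t₂, τ₁, τ₂, u₁, u₂, -, -, -, -, -, -, -, -, hlt₁, hlt₂, rfl⟩ :=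
    isSplittingDependency_iff.mp h
  by_cases hu1 : u = u₁
  · rwa [hu1]
  by_cases hu2 : u = u₂
  · rwa [hu2]
  simp [Ne.symm hus, Ne.symm hu1, Ne.symm hu2] at hu

/-- The computational basis vectors are linearly independent. -/
lemma eq_zero_of_mem_dependencies {α : states n →₀ ℂ} (h : α ∈ dependencies n)
    (hα : ∀ s ∈ noncomputational n, α s = 0) : α = 0 := by
  ext u
  by_contra hu
  have hket : ∀ s : states n, α s ≠ 0 → ∃ z, (s : Vec n) = ket z := fun s hs => by
    by_contra! hne
    exact hs (hα s hne)
  obtain ⟨z, hz⟩ := hket u hu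
  rw [dependencies, LinearMap.mem_ker, Finsupp.linearCombination_apply, Finsupp.sum] at h
  have hz0 := congrFun h z
  rw [Finset.sum_apply, Finset.sum_eq_single u] at hz0
  · simp [hz, ket] at hz0
    exact hu hz0
  · intro s hs hsu
    obtain ⟨w, hw⟩ := hket s (Finsupp.mem_support_iff.mp hs)
    have hwz : z ≠ w := by
      rintro rfl
      exact hsu (Subtype.ext (hw.trans hz.symm))
    simp [hw, ket, hwz]
  · intro hs
    simp [Finsupp.notMem_support_iff.mp hs]

/-- A family that is unitriangular on `N` with respect to a rank function is a basis of any space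
whose members are determined by their coordinates in `N`. -/
lemma exists_basis_of_triangular {ι K V : Type*} [Field K] [AddCommGroup V] [Module K V] [Finite ι]
    {N : Set ι} (e : ι → V →ₗ[K] K) (hV : ∀ α, (∀ s ∈ N, e s α = 0) → α = 0)
    (f : ι → ℕ) (D : N → V) (h1 : ∀ s : N, e s (D s) = 1)
    (hlt : ∀ (s : N) (u : ι), u ≠ s → e u (D s) ≠ 0 → f u < f s) :
    ∃ b : Basis N K V, ∀ s, b s = D s := by
  have := Fintype.ofFinite N
  have hli : LinearIndependent K D := by
    rw [Fintype.linearIndependent_iff]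
    intro g hg
    by_contra! hne
    -- At an index of maximal rank in the relation, no other `D t` has a nonzero coordinate, since
    -- that would force `t` to have larger rank.
    obtain ⟨s, hs, hmax⟩ := Set.exists_max_image {s | g s ≠ 0} (fun s => f s) (Set.toFinite _) hne
    refine hs ?_
    have h0 := congrArg (e s) hg
    rw [map_sum, map_zero, Finset.sum_eq_single s] at h0
    · simpa [h1] using h0
    · intro t _ hts
      by_cases hgt : g t = 0
      · simp [hgt]
      · by_contra hne0
        have : e s (D t) ≠ 0 := fun h => hne0 (by simp [h])
        exact absurd (hmax t hgt) (not_le.mpr (hlt t s (fun h => hts (Subtype.ext h.symm)) this))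
    · simp
  -- Restriction to the coordinates in `N` is injective, so the dimension is at most the size of `N`
  -- and the independent family spans.
  let res : V →ₗ[K] (N → K) := LinearMap.pi fun s : N => e s
  have hinj : Function.Injective res := by
    rw [← LinearMap.ker_eq_bot, LinearMap.ker_eq_bot']
    exact fun α hα => hV α fun s hs => congrFun hα ⟨s, hs⟩
  have : Module.Finite K V := Module.Finite.of_injective res hinj
  have hcard : finrank K V ≤ Fintype.card N :=
    (LinearMap.finrank_le_finrank_of_injective hinj).trans_eq (finrank_fintype_fun_eq_card K)
  have hspan := hli.span_eq_top_of_card_eq_finrank'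
    (le_antisymm hli.fintype_card_le_finrank hcard)
  exact ⟨Basis.mk hli hspan.ge, fun s => by rw [Basis.mk_apply]⟩

lemma exists_basis_dependencies (D : noncomputational n → states n →₀ ℂ)
    (hD : ∀ s : noncomputational n, IsSplittingDependency (s : states n) (D s)) :
    ∃ b : Basis (noncomputational n) ℂ (dependencies n),
      ∀ s, (b s : states n →₀ ℂ) = D s ∧ (D s).support.card = 3 := by
  have : Finite (states n) := finite_states n
  obtain ⟨b, hb⟩ := exists_basis_of_triangular
    (fun s : states n => Finsupp.lapply s ∘ₗ (dependencies n).subtype)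
    (fun α hα => Subtype.ext (eq_zero_of_mem_dependencies α.2 hα))
    (fun s => supportSize (s : Vec n)) (fun s => ⟨D s, (hD s).mem_dependencies⟩)
    (fun s => (hD s).apply_self) (fun s _ => (hD s).supportSize_lt)
  exact ⟨b, fun s => ⟨congrArg Subtype.val (hb s), (hD s).card_support⟩⟩

end Stabiliser

theorem theorem3 (n : ℕ) :
    -- there are finitely many states, so finitely supported functions on them are all functions
    (Stabiliser.states n).Finite ∧
    -- every noncomputational state has a splitting, hence an associated dependency
    (∀ s : Stabiliser.noncomputational n, ∃ d : Stabiliser.states n →₀ ℂ,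
      Stabiliser.IsSplittingDependency (s : Stabiliser.states n) d) ∧
    -- whatever the splittings chosen, the associated dependencies form a basis
    (∀ D : Stabiliser.noncomputational n → (Stabiliser.states n →₀ ℂ),
      (∀ s : Stabiliser.noncomputational n,
        Stabiliser.IsSplittingDependency (s : Stabiliser.states n) (D s)) →
        ∃ b : Module.Basis (Stabiliser.noncomputational n) ℂ (Stabiliser.dependencies n),
          ∀ s, (b s : Stabiliser.states n →₀ ℂ) = D s ∧ (D s).support.card = 3) ∧
    -- so there is a basis of vectors with support of size three
    (∃ b : Module.Basis (Stabiliser.noncomputational n) ℂ (Stabiliser.dependencies n),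
      ∀ s, (b s : Stabiliser.states n →₀ ℂ).support.card = 3) := by
  choose D hD using fun s : Stabiliser.noncomputational n =>
    Stabiliser.exists_isSplittingDependency s.2
  refine ⟨Stabiliser.finite_states n, fun s => ⟨D s, hD s⟩,
    Stabiliser.exists_basis_dependencies, ?_⟩
  obtain ⟨b, hb⟩ := Stabiliser.exists_basis_dependencies D hD
  exact ⟨b, fun s => by rw [(hb s).1, (hb s).2]⟩
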